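/- Let formulas be built from countably many propositional variables. By an intermediate (superintuitionistic) logic we mean a set $L$ of propositional formulas that contains intuitionistic logic $\mathbf{Int}$ and is closed under modus ponens and uniform substitution. Call $L$ ac-approximable if there is a class $\mathcal C$ of partially ordered Kripke frames without infinite (strictly) ascending chains such that $L$ is exactly the set of formulas valid in all frames of $\mathcal C$ under the intuitionistic Kripke semantics (where variables are interpreted by upward closed sets). Let $T$ be the Gödel–McKinsey–Tarski translation of propositional formulas into modal formulas, $T(p)=\Box p$, $T(\bot)=\Box\bot$, $T(\varphi\wedge\psi)=T(\varphi)\wedge T(\psi)$, $T(\varphi\vee\psi)=T(\varphi)\vee T(\psi)$, $T(\varphi\to\psi)=\Box(T(\varphi)\to T(\psi))$, and let $\tau L=\mathbf{Grz}\oplus\{T(\varphi):\varphi\in L\}$ be the modal companion of $L$ above $\mathbf{Grz}$, that is, the smallest normal modal logic containing $T(\varphi)$ for every $\varphi\in L$ and $\mathbf{Grz}=\mathbf{S4}\oplus\Box(\Box(p\to\Box p)\to p)\to p$. Then, for every intermediate logic $L$, $L$ is not ac-approximable if and only if $\tau L$ is Kripke-incomplete, that is, if and only if there is no class of Kripke frames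 (sets with an arbitrary binary relation) such that $\tau L$ is exactly the set of modal formulas valid in all frames of the class. -/

import Mathlib

universe u

namespace SILogic

/-! Intuitionistic propositional logic. -/

/-- Propositional formulas over the variables `p₀, p₁, …`. -/
inductive Form : Type
  | var : ℕ → Form
  | bot : Form
  | and : Form → Form → Form
  | or : Form → Form → Form
  | imp : Form → Form → Form

/-- Uniform substitution of formulas for variables. -/
def Form.subst (s : ℕ → Form) : Form → Form
  | .var n => s n
  | .bot => .bot
  | .and φ ψ => .and (φ.subst s) (ψ.subst s)
  | .or φ ψ => .or (φ.subst s) (ψ.subst s)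
  | .imp φ ψ => .imp (φ.subst s) (ψ.subst s)

/-- Intuitionistic propositional logic **Int**, as a Hilbert calculus. -/
inductive Int : Form → Prop
  | k (φ ψ : Form) : Int (.imp φ (.imp ψ φ))
  | s (φ ψ χ : Form) :
      Int (.imp (.imp φ (.imp ψ χ)) (.imp (.imp φ ψ) (.imp φ χ)))
  | and_left (φ ψ : Form) : Int (.imp (.and φ ψ) φ)
  | and_right (φ ψ : Form) : Int (.imp (.and φ ψ) ψ)
  | and_intro (φ ψ : Form) : Int (.imp φ (.imp ψ (.and φ ψ)))
  | or_left (φ ψ : Form) : Int (.imp φ (.or φ ψ))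
  | or_right (φ ψ : Form) : Int (.imp ψ (.or φ ψ))
  | or_elim (φ ψ χ : Form) :
      Int (.imp (.imp φ χ) (.imp (.imp ψ χ) (.imp (.or φ ψ) χ)))
  | efq (φ : Form) : Int (.imp .bot φ)
  | mp {φ ψ : Form} : Int (.imp φ ψ) → Int φ → Int ψ

/-- A superintuitionistic (intermediate) logic, identified with the set of its theorems: it
contains **Int** and is closed under modus ponens and uniform substitution. -/
structure IsLogic (L : Set Form) : Prop where
  int_subset : ∀ φ, Int φ → φ ∈ L
  mp : ∀ φ ψ, Form.imp φ ψ ∈ L → φ ∈ L → ψ ∈ L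
  subst : ∀ (s : ℕ → Form) φ, φ ∈ L → φ.subst s ∈ L

/-- An intuitionistic Kripke frame: a nonempty partially ordered set. -/
structure Frame : Type (u + 1) where
  World : Type u
  [nonempty : Nonempty World]
  [order : PartialOrder World]

attribute [instance] Frame.nonempty Frame.order

/-- Truth of a formula at a point of an intuitionistic Kripke model. The valuation sends
variables to upward closed sets. -/
def Forces {W : Type u} [PartialOrder W] (V : ℕ → UpperSet W) : W → Form → Prop
  | x, .var n => x ∈ V n
  | _, .bot => False
  | x, .and φ ψ => Forces V x φ ∧ Forces V x ψ
  | x, .or φ ψ => Forces V x φ ∨ Forces V x ψ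
  | x, .imp φ ψ => ∀ y, x ≤ y → Forces V y φ → Forces V y ψ

/-- A formula is true in a frame if it is true at all points under all valuations. -/
def Frame.Valid (F : Frame.{u}) (φ : Form) : Prop :=
  ∀ (V : ℕ → UpperSet F.World) (x : F.World), Forces V x φ

/-- The frame has no infinite (strictly) ascending chain. -/
def Frame.Noetherian (F : Frame.{u}) : Prop :=
  ∀ f : ℕ → F.World, ¬ StrictMono f

/-- `L` is ac-approximable: its theorems are exactly the formulas that are true in all frames
of some class of frames without infinite ascending chains. -/
def ACApproximable (L : Set Form) : Prop :=
  ∃ C : Set Frame.{u}, (∀ F ∈ C, F.Noetherian) ∧ L = {φ | ∀ F ∈ C, F.Valid φ}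

/-! Modal logic. -/

/-- Propositional modal formulas. -/
inductive MForm : Type
  | var : ℕ → MForm
  | bot : MForm
  | and : MForm → MForm → MForm
  | or : MForm → MForm → MForm
  | imp : MForm → MForm → MForm
  | box : MForm → MForm

/-- Uniform substitution of modal formulas for variables. -/
def MForm.subst (s : ℕ → MForm) : MForm → MForm
  | .var n => s n
  | .bot => .bot
  | .and φ ψ => .and (φ.subst s) (ψ.subst s)
  | .or φ ψ => .or (φ.subst s) (ψ.subst s)
  | .imp φ ψ => .imp (φ.subst s) (ψ.subst s)
  | .box φ => .box (φ.subst s)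

/-- `K ⊕ Γ`: the smallest normal modal logic containing `Γ`, that is, the closure of the axioms
of classical propositional logic, the axiom **K** and the formulas in `Γ` under modus ponens,
uniform substitution and necessitation. -/
inductive NormalExt (Γ : Set MForm) : MForm → Prop
  | k (φ ψ : MForm) : NormalExt Γ (.imp φ (.imp ψ φ))
  | s (φ ψ χ : MForm) :
      NormalExt Γ (.imp (.imp φ (.imp ψ χ)) (.imp (.imp φ ψ) (.imp φ χ)))
  | and_left (φ ψ : MForm) : NormalExt Γ (.imp (.and φ ψ) φ)
  | and_right (φ ψ : MForm) : NormalExt Γ (.imp (.and φ ψ) ψ)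
  | and_intro (φ ψ : MForm) : NormalExt Γ (.imp φ (.imp ψ (.and φ ψ)))
  | or_left (φ ψ : MForm) : NormalExt Γ (.imp φ (.or φ ψ))
  | or_right (φ ψ : MForm) : NormalExt Γ (.imp ψ (.or φ ψ))
  | or_elim (φ ψ χ : MForm) :
      NormalExt Γ (.imp (.imp φ χ) (.imp (.imp ψ χ) (.imp (.or φ ψ) χ)))
  | efq (φ : MForm) : NormalExt Γ (.imp .bot φ)
  | em (φ : MForm) : NormalExt Γ (.or φ (.imp φ .bot))
  | box_k (φ ψ : MForm) :
      NormalExt Γ (.imp (.box (.imp φ ψ)) (.imp (.box φ) (.box ψ)))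
  | ax {φ : MForm} : φ ∈ Γ → NormalExt Γ φ
  | mp {φ ψ : MForm} : NormalExt Γ (.imp φ ψ) → NormalExt Γ φ → NormalExt Γ ψ
  | subst (s : ℕ → MForm) {φ : MForm} : NormalExt Γ φ → NormalExt Γ (φ.subst s)
  | nec {φ : MForm} : NormalExt Γ φ → NormalExt Γ (.box φ)

/-- The axiom `□p → p`. -/
def axT : MForm := .imp (.box (.var 0)) (.var 0)

/-- The axiom `□p → □□p`. -/
def ax4 : MForm := .imp (.box (.var 0)) (.box (.box (.var 0)))

/-- Grzegorczyk's axiom `□(□(p → □p) → p) → p`. -/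
def axGrz : MForm :=
  .imp (.box (.imp (.box (.imp (.var 0) (.box (.var 0)))) (.var 0))) (.var 0)

/-- The Gödel–McKinsey–Tarski translation. -/
def Form.transl : Form → MForm
  | .var n => .box (.var n)
  | .bot => .box .bot
  | .and φ ψ => .and φ.transl ψ.transl
  | .or φ ψ => .or φ.transl ψ.transl
  | .imp φ ψ => .box (.imp φ.transl ψ.transl)

/-- The modal companion of `L` above **Grz**: the smallest normal modal logic that contains
**Grz** (that is, **S4** with Grzegorczyk's axiom) and the translations of all theorems of `L`. -/
def tau (L : Set Form) : Set MForm :=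
  {φ | NormalExt ({axT, ax4, axGrz} ∪ Form.transl '' L) φ}

/-- A Kripke frame for modal logic: a nonempty set with an arbitrary binary relation. -/
structure MFrame : Type (u + 1) where
  World : Type u
  [nonempty : Nonempty World]
  Rel : World → World → Prop

/-- Truth of a modal formula at a point of a Kripke model. -/
def MForces {W : Type u} (R : W → W → Prop) (V : ℕ → Set W) : W → MForm → Prop
  | x, .var n => x ∈ V n
  | _, .bot => False
  | x, .and φ ψ => MForces R V x φ ∧ MForces R V x ψ
  | x, .or φ ψ => MForces R V x φ ∨ MForces R V x ψ
  | x, .imp φ ψ => MForces R V x φ → MForces R V x ψ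
  | x, .box φ => ∀ y, R x y → MForces R V y φ

/-- A modal formula is true in a frame if it is true at all points under all valuations. -/
def MFrame.Valid (F : MFrame.{u}) (φ : MForm) : Prop :=
  ∀ (V : ℕ → Set F.World) (x : F.World), MForces F.Rel V x φ

/-- A modal logic is Kripke complete: its theorems are exactly the formulas that are true in all
frames of some class of Kripke frames. -/
def KripkeComplete (M : Set MForm) : Prop :=
  ∃ C : Set MFrame.{u}, M = {φ | ∀ F ∈ C, F.Valid φ}

end SILogic

namespace SILogic

/-! The frames of **Grz** are exactly the partial orders without infinite ascending chains
(`MFrame.exists_frame`, `Frame.valid_of_mem_tau`), and such a frame validates `T(a)` iff it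
validates `a`. So a class of frames for `τL` yields one for `L` as soon as `T(a) ∈ τL` forces `a ∈
L`. This is `mem_of_transl_mem_tau`: the canonical model of `L` satisfies `τL`, because sets
definable from upsets are Boolean combinations of finitely many upsets, and along a chain they can
change truth value only finitely often.

Conversely, a class that approximates `L` also determines `τL`. Over upset valuations, `□φ` is
equivalent to the translation of an intuitionistic formula (`mforces_conj_cnf`), so it suffices to
refute `φ ∉ τL` with upsets in place of arbitrary values. The key is `exists_boxBool_subst`: in the
canonical model of `τL`, a refuted `φ` has a refuted instance by Boolean combinations of boxed
formulas. Replacing the boxed formulas by variables gives an intuitionistic formula outside `L`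
(`exists_subst_conj_cnf_notMem`); a frame of the class refutes it, hence refutes an instance of `φ`,
hence `φ`. -/

/-! ### Prime extensions -/

/-- Closure of a set under modus ponens for the connective `imp`. -/
def MPClosed {α : Type*} (imp : α → α → α) (T : Set α) : Prop :=
  ∀ a b, imp a b ∈ T → a ∈ T → b ∈ T

/-- The disjunction property of a set for the connective `or`. -/
def DisjProp {α : Type*} (or : α → α → α) (T : Set α) : Prop :=
  ∀ a b, or a b ∈ T → a ∈ T ∨ b ∈ T

/-- Zorn's lemma gives a maximal closed set omitting `c`, and maximality yields primeness. The
connectives are parameters, so that one proof serves both intuitionistic and modal theories. -/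
theorem exists_prime_extension {α : Type*} {imp or : α → α → α} {T : Set α}
    (hk : ∀ a b, imp a (imp b a) ∈ T)
    (hs : ∀ a b c, imp (imp a (imp b c)) (imp (imp a b) (imp a c)) ∈ T)
    (hor : ∀ a b c, imp (imp a c) (imp (imp b c) (imp (or a b) c)) ∈ T)
    (hmp : MPClosed imp T) {c : α} (hc : c ∉ T) :
    ∃ U, T ⊆ U ∧ MPClosed imp U ∧ DisjProp or U ∧ c ∉ U := by
  obtain ⟨U, hTU, hU⟩ := zorn_subset_nonempty {U : Set α | T ⊆ U ∧ MPClosed imp U ∧ c ∉ U}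
    (by
      intro C hC hchain hne
      refine ⟨⋃₀ C, ⟨?_, ?_, ?_⟩, fun s hs => Set.subset_sUnion_of_mem hs⟩
      · obtain ⟨s, hs⟩ := hne
        exact (hC hs).1.trans (Set.subset_sUnion_of_mem hs)
      · rintro a b ⟨s, hs, has⟩ ⟨t, ht, hat⟩
        rcases hchain.total hs ht with h | h
        · exact ⟨t, ht, (hC ht).2.1 a b (h has) hat⟩
        · exact ⟨s, hs, (hC hs).2.1 a b has (h hat)⟩
      · rintro ⟨s, hs, hcs⟩
        exact (hC hs).2.2 hcs)
    T ⟨le_rfl, hmp, hc⟩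
  obtain ⟨-, hUmp, hcU⟩ := hU.prop
  have key : ∀ a, a ∉ U → imp a c ∈ U := by
    intro a ha
    by_contra hac
    -- By the deduction theorem, this set is the theory generated by `U` and `a`. If it omitted `c`,
    -- maximality would put `a` into `U`.
    refine ha (hU.le_of_ge (y := {b | imp a b ∈ U}) ⟨?_, ?_, hac⟩ ?_ ?_)
    · exact fun b hb => hUmp _ _ (hTU (hk b a)) (hTU hb)
    · exact fun b d hbd hb => hUmp _ _ (hUmp _ _ (hTU (hs a b d)) hbd) hb
    · exact fun b hb => hUmp _ _ (hTU (hk b a)) hb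
    · exact hUmp _ _ (hUmp _ _ (hTU (hs a (imp a a) a)) (hTU (hk a (imp a a)))) (hTU (hk a a))
  refine ⟨U, hTU, hUmp, fun a b hab => ?_, hcU⟩
  by_contra! h
  exact hcU (hUmp _ _ (hUmp _ _ (hUmp _ _ (hTU (hor a b c)) (key a h.1)) (key b h.2)) hab)

/-! ### Basic semantic facts -/

variable {W : Type*} {R : W → W → Prop} {V : ℕ → Set W}

theorem MForm.subst_subst (s t : ℕ → MForm) (φ : MForm) :
    (φ.subst s).subst t = φ.subst fun n => (s n).subst t := by
  induction φ <;> simp_all [MForm.subst]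

theorem mforces_subst (s : ℕ → MForm) (φ : MForm) (x : W) :
    MForces R V x (φ.subst s) ↔ MForces R (fun n => {y | MForces R V y (s n)}) x φ := by
  induction φ generalizing x <;> simp_all [MForm.subst, MForces]

theorem transl_persistent (hR : ∀ x y z, R x y → R y z → R x z) (a : Form) {x y : W}
    (hxy : R x y) (h : MForces R V x a.transl) : MForces R V y a.transl := by
  induction a with
  | var n => exact fun z hz => h z (hR _ _ _ hxy hz)
  | bot => exact fun z hz => h z (hR _ _ _ hxy hz)
  | and a b iha ihb => exact ⟨iha h.1, ihb h.2⟩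
  | or a b iha ihb => exact h.imp iha ihb
  | imp a b => exact fun z hz => h z (hR _ _ _ hxy hz)

theorem mforces_transl_iff {W : Type*} [PartialOrder W] (V : ℕ → UpperSet W) (a : Form) (x : W) :
    MForces (· ≤ ·) (fun n => (V n : Set W)) x a.transl ↔ Forces V x a := by
  induction a generalizing x with
  | var n => exact ⟨fun h => h x le_rfl, fun h y hy => (V n).upper hy h⟩
  | bot => exact ⟨fun h => h x le_rfl, False.elim⟩
  | and a b iha ihb => exact and_congr (iha x) (ihb x)
  | or a b iha ihb => exact or_congr (iha x) (ihb x)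
  | imp a b iha ihb =>
    exact forall_congr' fun y => imp_congr_right fun _ => imp_congr (iha y) (ihb y)

/-- Grzegorczyk's axiom holds for a set between which and its complement one can only
alternate finitely often. -/
theorem mforces_axGrz_of_wellFounded (hR : ∀ x y z, R x y → R y z → R x z)
    (hrefl : ∀ x, R x x) {r : W → W → Prop} (hr : WellFounded r)
    (h : ∀ x y z, x ∉ V 0 → R x y → y ∈ V 0 → R y z → z ∉ V 0 → r z x) (x : W) :
    MForces R V x axGrz := by
  induction x using hr.induction with
  | _ x ih =>
    intro hx
    by_contra hxp
    refine hxp (hx x (hrefl x) fun y hxy hy z hyz => ?_)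
    -- At such a `z` the premise of the axiom is inherited from `x` and the axiom itself holds by
    -- induction, so `z ∈ V 0`.
    by_contra hz
    exact hz (ih z (h x y z hxp hxy hy hyz hz) fun w hw => hx w (hR _ _ _ (hR _ _ _ hxy hyz) hw))

/-- Soundness for a single model rather than a frame: the axioms need only hold for definable values
of the variables. Quantifying over `s` lets the induction pass through the substitution rule. -/
theorem mforces_of_normalExt {Γ : Set MForm}
    (hΓ : ∀ φ ∈ Γ, ∀ s x, MForces R V x (φ.subst s)) {φ : MForm} (h : NormalExt Γ φ)
    (s : ℕ → MForm) (x : W) : MForces R V x (φ.subst s) := by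
  induction h generalizing s x with
  | k | s | and_left | and_right | and_intro | or_left | or_right | efq | box_k =>
    simp only [MForm.subst, MForces]; tauto
  | or_elim => simp only [MForm.subst, MForces]; tauto
  | em => simp only [MForm.subst, MForces]; tauto
  | ax h => exact hΓ _ h s x
  | mp _ _ ih₁ ih₂ => exact ih₁ s x (ih₂ s x)
  | subst t _ ih => rw [MForm.subst_subst]; exact ih _ x
  | nec _ ih => exact fun y _ => ih s y

/-! ### Conjunctive normal forms over translations -/

namespace Form

/-- Truth. -/
def top : Form := .imp .bot .bot

/-- Disjunction of two conjunctions of implications. -/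
def cnfOr (l m : List (Form × Form)) : List (Form × Form) :=
  l.flatMap fun p => m.map fun q => (.and p.1 q.1, .or p.2 q.2)

/-- Negation of a conjunction of implications. -/
def cnfNot : List (Form × Form) → List (Form × Form)
  | [] => [(top, bot)]
  | p :: l => cnfOr [(top, p.1), (p.2, bot)] (cnfNot l)

/-- The conjunction of a list of implications. -/
def conj : List (Form × Form) → Form
  | [] => top
  | p :: l => .and (.imp p.1 p.2) (conj l)

end Form

open Form in
/-- A modal formula written as a conjunction of implications between translations, in models
where variables denote upward closed sets. -/
def MForm.cnf : MForm → List (Form × Form)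
  | .var n => [(top, .var n)]
  | .bot => [(top, .bot)]
  | .and φ ψ => φ.cnf ++ ψ.cnf
  | .or φ ψ => cnfOr φ.cnf ψ.cnf
  | .imp φ ψ => cnfOr (cnfNot φ.cnf) ψ.cnf
  | .box φ => [(top, conj φ.cnf)]

/-- Truth of a conjunction of implications between translations. -/
def CnfForces (R : W → W → Prop) (V : ℕ → Set W) (x : W) (l : List (Form × Form)) : Prop :=
  ∀ p ∈ l, MForces R V x p.1.transl → MForces R V x p.2.transl

theorem mforces_top (x : W) : MForces R V x Form.top.transl := fun _ _ h => h

theorem cnfForces_or (x : W) (l m : List (Form × Form)) :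
    CnfForces R V x (Form.cnfOr l m) ↔ CnfForces R V x l ∨ CnfForces R V x m := by
  constructor
  · intro h
    by_contra! hn
    simp only [CnfForces, not_forall] at hn
    obtain ⟨⟨p, hp, h1, h2⟩, q, hq, h3, h4⟩ := hn
    have := h (.and p.1 q.1, .or p.2 q.2)
      (List.mem_flatMap.2 ⟨p, hp, List.mem_map.2 ⟨q, hq, rfl⟩⟩) ⟨h1, h3⟩
    exact this.elim h2 h4
  · intro h r hr
    obtain ⟨p, hp, hr⟩ := List.mem_flatMap.1 hr
    obtain ⟨q, hq, rfl⟩ := List.mem_map.1 hr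
    exact fun ⟨h1, h2⟩ => h.imp (fun h => h p hp h1) (fun h => h q hq h2)

theorem mforces_transl_bot (hrefl : ∀ x, R x x) (x : W) : ¬ MForces R V x Form.bot.transl :=
  fun h => h x (hrefl x)

theorem cnfForces_not (hrefl : ∀ x, R x x) (x : W) (l : List (Form × Form)) :
    CnfForces R V x (Form.cnfNot l) ↔ ¬ CnfForces R V x l := by
  have hb := mforces_transl_bot (V := V) hrefl x
  have ht := mforces_top (R := R) (V := V) x
  induction l with
  | nil => simp [Form.cnfNot, CnfForces, hb, ht]
  | cons p l ih =>
    refine (cnfForces_or x _ _).trans ((or_congr_right ih).trans ?_)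
    simp only [CnfForces, List.forall_mem_cons, List.not_mem_nil, false_imp_iff, implies_true,
      and_true, ht, hb]
    tauto

/-- Translated implications carry their own box, and boxes commute with conjunction. -/
theorem mforces_conj (x : W) (l : List (Form × Form)) :
    MForces R V x (Form.conj l).transl ↔ ∀ y, R x y → CnfForces R V y l := by
  induction l with
  | nil => simp [Form.conj, CnfForces, mforces_top]
  | cons p l ih =>
    simp only [Form.conj, Form.transl, MForces, ih, CnfForces, List.forall_mem_cons]
    exact ⟨fun h y hy => ⟨h.1 y hy, h.2 y hy⟩, fun h => ⟨fun y hy => (h y hy).1,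
      fun y hy => (h y hy).2⟩⟩

theorem cnfForces_cnf (hrefl : ∀ x, R x x) (hV : ∀ n x y, R x y → x ∈ V n → y ∈ V n)
    (φ : MForm) (x : W) : CnfForces R V x φ.cnf ↔ MForces R V x φ := by
  have hb : ∀ x, ¬ MForces R V x Form.bot.transl := mforces_transl_bot (V := V) hrefl
  have ht : ∀ x, MForces R V x Form.top.transl := mforces_top (R := R) (V := V)
  induction φ generalizing x with
  | var n =>
    simp only [MForm.cnf, CnfForces, List.forall_mem_singleton, ht, true_imp_iff]
    exact ⟨fun h => h x (hrefl x), fun h y hy => hV n x y hy h⟩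
  | bot => simpa [MForm.cnf, CnfForces, ht, MForces] using hb x
  | and φ ψ ih₁ ih₂ =>
    simp only [MForm.cnf, MForces, ← ih₁, ← ih₂, CnfForces, List.forall_mem_append]
  | or φ ψ ih₁ ih₂ => simp only [MForm.cnf, MForces, ← ih₁, ← ih₂, cnfForces_or]
  | imp φ ψ ih₁ ih₂ =>
    simp only [MForm.cnf, MForces, ← ih₁, ← ih₂, cnfForces_or, cnfForces_not hrefl]
    tauto
  | box φ ih =>
    simp only [MForm.cnf, MForces, ← ih, ← mforces_conj]
    simp [CnfForces, ht]

theorem mforces_conj_cnf (hrefl : ∀ x, R x x) (hV : ∀ n x y, R x y → x ∈ V n → y ∈ V n)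
    (φ : MForm) (x : W) :
    MForces R V x (Form.conj φ.cnf).transl ↔ MForces R V x (.box φ) := by
  simp only [mforces_conj, cnfForces_cnf hrefl hV, MForces]

/-! ### The canonical model of a superintuitionistic logic -/

/-- The prime theories of a superintuitionistic logic. -/
def PrimeTheory (L : Set Form) : Type :=
  {T : Set Form // L ⊆ T ∧ MPClosed .imp T ∧ DisjProp .or T ∧ Form.bot ∉ T}

/-- Inclusion of prime theories. -/
def PrimeTheory.Rel {L : Set Form} (x y : PrimeTheory L) : Prop := x.1 ⊆ y.1

/-- The canonical valuation on prime theories. -/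
def PrimeTheory.val (L : Set Form) (n : ℕ) : Set (PrimeTheory L) := {x | Form.var n ∈ x.1}

theorem IsLogic.exists_primeTheory {L T : Set Form} (hL : IsLogic L) (hLT : L ⊆ T)
    (hT : MPClosed .imp T) {c : Form} (hc : c ∉ T) :
    ∃ x : PrimeTheory L, T ⊆ x.1 ∧ c ∉ x.1 := by
  have hi : ∀ φ, Int φ → φ ∈ T := fun φ h => hLT (hL.int_subset φ h)
  obtain ⟨U, h1, h2, h3, h4⟩ := exists_prime_extension (fun a b => hi _ (.k a b))
    (fun a b c => hi _ (.s a b c)) (fun a b c => hi _ (.or_elim a b c)) hT hc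
  exact ⟨⟨U, hLT.trans h1, h2, h3, fun h => h4 (h2 _ _ (h1 (hi _ (.efq c))) h)⟩, h1, h4⟩

theorem IsLogic.mforces_transl_iff_mem {L : Set Form} (hL : IsLogic L) (a : Form)
    (x : PrimeTheory L) :
    MForces PrimeTheory.Rel (PrimeTheory.val L) x a.transl ↔ a ∈ x.1 := by
  induction a generalizing x with
  | var n => exact ⟨fun h => h x fun _ => id, fun h y hy => hy h⟩
  | bot => exact ⟨fun h => (h x fun _ => id).elim, fun h => (x.2.2.2.2 h).elim⟩
  | and a b iha ihb =>
    obtain ⟨hLT, hT, -⟩ := x.2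
    simp only [Form.transl, MForces, iha, ihb]
    have hi : ∀ φ, Int φ → φ ∈ x.1 := fun φ h => hLT (hL.int_subset φ h)
    exact ⟨fun h => hT _ _ (hT _ _ (hi _ (.and_intro a b)) h.1) h.2,
      fun h => ⟨hT _ _ (hi _ (.and_left a b)) h, hT _ _ (hi _ (.and_right a b)) h⟩⟩
  | or a b iha ihb =>
    obtain ⟨hLT, hT, hd, -⟩ := x.2
    simp only [Form.transl, MForces, iha, ihb]
    have hi : ∀ φ, Int φ → φ ∈ x.1 := fun φ h => hLT (hL.int_subset φ h)
    exact ⟨fun h => h.elim (hT _ _ (hi _ (.or_left a b))) (hT _ _ (hi _ (.or_right a b))), hd a b⟩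
  | imp a b iha ihb =>
    simp only [Form.transl, MForces, iha, ihb]
    refine ⟨fun h => ?_, fun h y hy ha => y.2.2.1 _ _ (hy h) ha⟩
    by_contra hab
    have hT := x.2.2.1
    have hi : ∀ φ, Int φ → φ ∈ x.1 := fun φ h => x.2.1 (hL.int_subset φ h)
    -- If `a → b` is not in `x`, the theory generated by `x` and `a` omits `b`; a prime extension of
    -- it is a successor refuting the implication.
    have hx : x.1 ⊆ {c | Form.imp a c ∈ x.1} := fun c hc => hT _ _ (hi _ (.k c a)) hc
    obtain ⟨y, hy, hby⟩ := hL.exists_primeTheory (T := {c | Form.imp a c ∈ x.1})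
      (x.2.1.trans hx) (fun c d hcd hc => hT _ _ (hT _ _ (hi _ (.s a c d)) hcd) hc) hab
    refine hby (h y (hx.trans hy) (hy ?_))
    exact hT _ _ (hT _ _ (hi _ (.s a (.imp a a) a)) (hi _ (.k a (.imp a a)))) (hi _ (.k a a))

/-- Only boxed variables occur in a translation, and `□(s n)` is itself equivalent to a translation.
Since `L` is closed under substitution, its canonical model therefore satisfies every modal instance
of `T(a)` for `a ∈ L`. -/
theorem mforces_transl_subst (hrefl : ∀ x, R x x)
    (hV : ∀ n x y, R x y → x ∈ V n → y ∈ V n) (s : ℕ → MForm) (a : Form) (x : W) :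
    MForces R V x (a.transl.subst s) ↔
      MForces R V x (a.subst fun n => .conj (s n).cnf).transl := by
  induction a generalizing x with
  | var n => exact (mforces_conj_cnf hrefl hV (s n) x).symm
  | bot => rfl
  | and a b iha ihb => exact and_congr (iha x) (ihb x)
  | or a b iha ihb => exact or_congr (iha x) (ihb x)
  | imp a b iha ihb =>
    exact forall_congr' fun y => imp_congr_right fun _ => imp_congr (iha y) (ihb y)

/-- Definable sets of a preordered model with upward closed valuation satisfy Grzegorczyk's
axiom. -/
theorem mforces_axGrz_subst (hR : ∀ x y z, R x y → R y z → R x z) (hrefl : ∀ x, R x x)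
    (hV : ∀ n x y, R x y → x ∈ V n → y ∈ V n) (s : ℕ → MForm) (x : W) :
    MForces R V x (axGrz.subst s) := by
  classical
  rw [mforces_subst]
  set l : List Form := (s 0).cnf.flatMap fun p => [p.1, p.2]
  -- Translations persist upward, so this count never grows; it drops strictly when `s 0` goes from
  -- false to true to false, since its truth depends only on the members of `l`.
  let m : W → ℕ := fun x => (l.toFinset.filter fun a => ¬ MForces R V x a.transl).card
  refine mforces_axGrz_of_wellFounded hR hrefl (InvImage.wf m wellFounded_lt)
    (fun x y z hx hxy hy hyz _ => ?_) x
  refine Finset.card_lt_card ⟨fun a ha => ?_, fun hsub => hx ?_⟩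
  · rw [Finset.mem_filter] at ha ⊢
    exact ⟨ha.1, fun h => ha.2 (transl_persistent hR a (hR _ _ _ hxy hyz) h)⟩
  · have hback : ∀ a ∈ l, MForces R V y a.transl → MForces R V x a.transl := by
      intro a ha hya
      by_contra hxa
      have := hsub (Finset.mem_filter.2 ⟨List.mem_toFinset.2 ha, hxa⟩)
      exact (Finset.mem_filter.1 this).2 (transl_persistent hR a hyz hya)
    change MForces R V x (s 0)
    change MForces R V y (s 0) at hy
    rw [← cnfForces_cnf hrefl hV] at hy ⊢
    intro p hp h1
    exact hback _ (List.mem_flatMap.2 ⟨p, hp, by simp⟩)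
      (hy p hp (transl_persistent hR _ hxy h1))

theorem mem_of_transl_mem_tau {L : Set Form} (hL : IsLogic L) {a : Form}
    (ha : a.transl ∈ tau L) : a ∈ L := by
  by_contra haL
  obtain ⟨x, -, hx⟩ := hL.exists_primeTheory le_rfl hL.mp haL
  rw [← hL.mforces_transl_iff_mem] at hx
  refine hx ?_
  have hR : ∀ x y z : PrimeTheory L, x.Rel y → y.Rel z → x.Rel z := fun _ _ _ h => h.trans
  have hrefl : ∀ x : PrimeTheory L, x.Rel x := fun x _ => id
  have hV : ∀ n (x y : PrimeTheory L), x.Rel y → x ∈ PrimeTheory.val L n →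
    y ∈ PrimeTheory.val L n := fun n x y h hx => h hx
  have h1 := fun s => mforces_of_normalExt (R := PrimeTheory.Rel) (V := PrimeTheory.val L)
    (fun φ hφ s x => ?_) ha s x
  · have h2 := h1 .var
    rw [mforces_subst] at h2
    exact h2
  · rcases hφ with (rfl | rfl | rfl) | ⟨b, hb, rfl⟩
    · exact fun h => h x (hrefl x)
    · exact fun h y hy z hz => h z (hR _ _ _ hy hz)
    · exact mforces_axGrz_subst hR hrefl hV s x
    · rw [mforces_transl_subst hrefl hV, hL.mforces_transl_iff_mem]
      exact x.2.1 (hL.subst _ _ hb)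

/-! ### The canonical model of a normal modal logic -/

/-- The maximal consistent sets of a modal logic. -/
def MaxTheory (M : Set MForm) : Type :=
  {T : Set MForm // M ⊆ T ∧ MPClosed .imp T ∧ DisjProp .or T ∧ MForm.bot ∉ T}

/-- The canonical accessibility relation. -/
def MaxTheory.Rel {M : Set MForm} (x y : MaxTheory M) : Prop := ∀ φ, .box φ ∈ x.1 → φ ∈ y.1

/-- The canonical valuation on maximal consistent sets. -/
def MaxTheory.val (M : Set MForm) (n : ℕ) : Set (MaxTheory M) := {x | MForm.var n ∈ x.1}

theorem exists_maxTheory {Γ T : Set MForm} (hΓT : {φ | NormalExt Γ φ} ⊆ T)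
    (hT : MPClosed .imp T) {c : MForm} (hc : c ∉ T) :
    ∃ x : MaxTheory {φ | NormalExt Γ φ}, T ⊆ x.1 ∧ c ∉ x.1 := by
  obtain ⟨U, h1, h2, h3, h4⟩ := exists_prime_extension (fun a b => hΓT (.k a b))
    (fun a b c => hΓT (.s a b c)) (fun a b c => hΓT (.or_elim a b c)) hT hc
  exact ⟨⟨U, hΓT.trans h1, h2, h3, fun h => h4 (h2 _ _ (h1 (hΓT (.efq c))) h)⟩, h1, h4⟩

theorem mforces_iff_mem {Γ : Set MForm} (φ : MForm) (x : MaxTheory {φ | NormalExt Γ φ}) :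
    MForces MaxTheory.Rel (MaxTheory.val _) x φ ↔ φ ∈ x.1 := by
  induction φ generalizing x with
  | var n => rfl
  | bot => exact ⟨False.elim, x.2.2.2.2⟩
  | and a b iha ihb =>
    obtain ⟨hi, hT, -⟩ := x.2
    simp only [MForces, iha, ihb]
    exact ⟨fun h => hT _ _ (hT _ _ (hi (.and_intro a b)) h.1) h.2,
      fun h => ⟨hT _ _ (hi (.and_left a b)) h, hT _ _ (hi (.and_right a b)) h⟩⟩
  | or a b iha ihb =>
    obtain ⟨hi, hT, hd, -⟩ := x.2
    simp only [MForces, iha, ihb]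
    exact ⟨fun h => h.elim (hT _ _ (hi (.or_left a b))) (hT _ _ (hi (.or_right a b))), hd a b⟩
  | imp a b iha ihb =>
    obtain ⟨hi, hT, hd, hb⟩ := x.2
    simp only [MForces, iha, ihb]
    refine ⟨fun h => ?_, fun h ha => hT _ _ h ha⟩
    rcases hd _ _ (hi (.em a)) with ha | ha
    · exact hT _ _ (hi (.k b a)) (h ha)
    · exact hT _ _ (hT _ _ (hi (.s a .bot b)) (hT _ _ (hi (.k _ a)) (hi (.efq b)))) ha
  | box a iha =>
    simp only [MForces, iha]
    refine ⟨fun h => ?_, fun h y hy => hy a h⟩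
    by_contra ha
    have hT := x.2.2.1
    have hi : ∀ φ, NormalExt Γ φ → φ ∈ x.1 := fun φ h => x.2.1 h
    obtain ⟨y, hy, hay⟩ := exists_maxTheory (T := {b | MForm.box b ∈ x.1})
      (fun b hb => hi b.box (.nec hb))
      (fun b c hbc hb => hT b.box c.box (hT (b.imp c).box _ (hi _ (.box_k b c)) hbc) hb) ha
    exact hay (h y fun b hb => hy hb)

/-! ### Boolean combinations of boxed formulas -/

/-- Boolean combinations of boxed formulas. -/
inductive BoxBool : MForm → Prop
  | box (φ : MForm) : BoxBool (.box φ)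
  | bot : BoxBool .bot
  | and {φ ψ : MForm} : BoxBool φ → BoxBool ψ → BoxBool (.and φ ψ)
  | imp {φ ψ : MForm} : BoxBool φ → BoxBool ψ → BoxBool (.imp φ ψ)

/-- A set that does not separate points indistinguishable by finitely many members of a field
of sets belongs to that field. -/
theorem mem_field_of_saturated {D : Set (Set W)} (huniv : Set.univ ∈ D)
    (hcompl : ∀ X ∈ D, Xᶜ ∈ D) (hinter : ∀ X ∈ D, ∀ Y ∈ D, X ∩ Y ∈ D) {ι : Type*} {I : Set ι}
    (hI : I.Finite) {S : ι → Set W} (hS : ∀ i ∈ I, S i ∈ D) {A : Set W}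
    (hA : ∀ x y, (∀ i ∈ I, x ∈ S i ↔ y ∈ S i) → x ∈ A → y ∈ A) : A ∈ D := by
  have hunion : ∀ X ∈ D, ∀ Y ∈ D, X ∪ Y ∈ D := by
    intro X hX Y hY
    have := hcompl _ (hinter _ (hcompl X hX) _ (hcompl Y hY))
    rwa [Set.compl_inter, compl_compl, compl_compl] at this
  -- A saturated set is given by a condition on the trace `{i ∈ I | x ∈ S i}`; arbitrary conditions
  -- make the induction on `I` work.
  suffices ∀ Q : Set ι → Prop, {x | Q {i ∈ I | x ∈ S i}} ∈ D by
    convert this fun J => ∃ x ∈ A, J = {i ∈ I | x ∈ S i}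
    ext y
    refine ⟨fun hy => ⟨y, hy, rfl⟩, fun ⟨x, hx, h⟩ => hA x y (fun i hi => ?_) hx⟩
    have := Set.ext_iff.1 h i
    simp only [Set.mem_sep_iff, hi, true_and] at this
    exact this.symm
  clear hA
  induction I, hI using Set.Finite.induction_on with
  | empty =>
    intro Q
    by_cases hQ : Q ∅
    · simpa [hQ] using huniv
    · simpa [hQ] using hcompl _ huniv
  | @insert a I _ _ ih =>
    intro Q
    have ih := ih fun i hi => hS i (Set.mem_insert_of_mem a hi)
    have ha := hS a (Set.mem_insert a I)
    convert hunion _ (hinter _ ha _ (ih fun J => Q (insert a J))) _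
      (hinter _ (hcompl _ ha) _ (ih Q)) using 1
    ext x
    by_cases hx : x ∈ S a
    · have : {i | i ∈ insert a I ∧ x ∈ S i} = insert a {i | i ∈ I ∧ x ∈ S i} := by
        ext i
        by_cases hi : i = a <;> simp [hi, hx]
      rw [Set.mem_ofPred_eq, this]
      simp [hx]
    · have : {i | i ∈ insert a I ∧ x ∈ S i} = {i | i ∈ I ∧ x ∈ S i} := by
        ext i
        by_cases hi : i = a <;> simp [hi, hx]
      rw [Set.mem_ofPred_eq, this]
      simp [hx]

/-- The set of subformulas. -/
def MForm.sub : MForm → Set MForm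
  | .var n => {.var n}
  | .bot => {.bot}
  | .and φ ψ => insert (.and φ ψ) (φ.sub ∪ ψ.sub)
  | .or φ ψ => insert (.or φ ψ) (φ.sub ∪ ψ.sub)
  | .imp φ ψ => insert (.imp φ ψ) (φ.sub ∪ ψ.sub)
  | .box φ => insert (.box φ) φ.sub

theorem MForm.sub_finite (φ : MForm) : φ.sub.Finite := by
  induction φ <;> simp_all [MForm.sub]

theorem MForm.self_mem_sub (φ : MForm) : φ ∈ φ.sub := by
  cases φ <;> simp [MForm.sub]

/-- The formulas of `S` true at a point. -/
def typeOf (R : W → W → Prop) (V : ℕ → Set W) (S : Set MForm) (x : W) : Set MForm :=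
  {ψ ∈ S | MForces R V x ψ}

/-- A function picking, with every point, a type whose boxed formulas are those of the point,
so that every type of a point is picked somewhere above it, is a type function of a model. -/
theorem mforces_iff_of_type_function (hrefl : ∀ x, R x x) (hR : ∀ x y z, R x y → R y z → R x z)
    {S : Set MForm} {e : W → W} (hbox : ∀ x ψ, .box ψ ∈ S →
      (MForces R V (e x) (.box ψ) ↔ MForces R V x (.box ψ)))
    (hpick : ∀ x, ∃ y, R x y ∧ ∀ ψ ∈ S, MForces R V (e y) ψ ↔ MForces R V x ψ)
    {V' : ℕ → Set W} (hV' : ∀ n, .var n ∈ S → ∀ x, x ∈ V' n ↔ e x ∈ V n)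
    (ψ : MForm) (hψ : ψ.sub ⊆ S) (x : W) : MForces R V' x ψ ↔ MForces R V (e x) ψ := by
  induction ψ generalizing x with
  | var n => exact hV' n (hψ (MForm.self_mem_sub _)) x
  | bot => rfl
  | and a b iha ihb | or a b iha ihb | imp a b iha ihb =>
    have h := (Set.subset_insert _ _).trans hψ
    simp only [MForces, iha (Set.subset_union_left.trans h), ihb (Set.subset_union_right.trans h)]
  | box a iha =>
    have h : a.sub ⊆ S := (Set.subset_insert _ _).trans hψ
    have hb := hψ (MForm.self_mem_sub _)
    rw [hbox x a hb]
    refine ⟨fun hx y hxy => ?_, fun hx y hxy => (iha h y).2 ?_⟩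
    -- The type of `y` is picked at some `z` above `y`, where the box at `x` applies.
    · obtain ⟨z, hyz, hz⟩ := hpick y
      exact (hz a (h (MForm.self_mem_sub a))).1 ((iha h z).1 (hx z (hR _ _ _ hxy hyz)))
    · exact (hbox y a hb).2 (fun z hz => hx z (hR _ _ _ hxy hz)) (e y) (hrefl _)

/-- In a model of all instances of **Grz**, a refuted formula has a refuted substitution instance
by Boolean combinations of boxed formulas. -/
theorem exists_boxBool_subst (hrefl : ∀ x, R x x) (hR : ∀ x y z, R x y → R y z → R x z)
    (hGrz : ∀ s x, MForces R V x (axGrz.subst s)) {φ : MForm} {x : W}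
    (hx : ¬ MForces R V x φ) :
    ∃ s : ℕ → MForm, (∀ n, BoxBool (s n)) ∧ ∃ y, ¬ MForces R V y (φ.subst s) := by
  classical
  set S := φ.sub
  let tp := typeOf R V S
  have htp : ∀ {x y}, tp x = tp y → ∀ ψ ∈ S, MForces R V x ψ ↔ MForces R V y ψ := by
    intro x y h ψ hψ
    have := Set.ext_iff.1 h ψ
    simpa [tp, typeOf, hψ] using this
  have htpfin : (Set.range tp).Finite :=
    (φ.sub_finite.powerset).subset (by rintro _ ⟨x, rfl⟩; exact Set.sep_subset _ _)
  -- points from which one never returns to their type after leaving it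
  let P : W → Prop := fun x => ∀ y, R x y → tp y ≠ tp x → ∀ z, R y z → tp z ≠ tp x
  let D : Set (Set W) := {X | ∃ θ, BoxBool θ ∧ X = {x | MForces R V x θ}}
  have hDcompl : ∀ X ∈ D, Xᶜ ∈ D := by
    rintro _ ⟨θ, hθ, rfl⟩
    exact ⟨_, hθ.imp .bot, rfl⟩
  have hDuniv : Set.univ ∈ D := ⟨.imp .bot .bot, BoxBool.bot.imp .bot, by
    ext; simp [MForces]⟩
  have hDinter : ∀ X ∈ D, ∀ Y ∈ D, X ∩ Y ∈ D := by
    rintro _ ⟨θ, hθ, rfl⟩ _ ⟨θ', hθ', rfl⟩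
    exact ⟨_, hθ.and hθ', rfl⟩
  have hXt : ∀ t, ∃ χ, ∀ x, tp x = t ↔ MForces R V x χ := by
    intro t
    have : {x | tp x = t} ∈ {X | ∃ χ, X = {x | MForces R V x χ}} := by
      refine mem_field_of_saturated (D := {X | ∃ χ, X = {x | MForces R V x χ}}) (I := S) (S := fun ψ => {x | MForces R V x ψ}) ?_ ?_ ?_
        φ.sub_finite (fun ψ _ => ⟨ψ, rfl⟩) ?_
      · exact ⟨.imp .bot .bot, by ext; simp [MForces]⟩
      · rintro _ ⟨θ, rfl⟩
        exact ⟨.imp θ .bot, rfl⟩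
      · rintro _ ⟨θ, rfl⟩ _ ⟨θ', rfl⟩
        exact ⟨.and θ θ', rfl⟩
      · intro x y h hx
        rw [Set.mem_ofPred_eq] at hx ⊢
        rw [← hx]
        ext ψ
        simp only [tp, typeOf, Set.mem_sep_iff]
        exact and_congr_right fun hψ => (h ψ hψ).symm
    obtain ⟨χ, hχ⟩ := this
    exact ⟨χ, fun x => Set.ext_iff.1 hχ x⟩
  have hPt : ∀ t, {x | tp x = t ∧ P x} ∈ D := by
    intro t
    obtain ⟨χ, hχ⟩ := hXt t
    -- The formula is `□(¬χ → □¬χ) ∧ ¬□¬χ`. By reflexivity it already implies `χ`, so `χ` need not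
    -- appear outside a box.
    refine ⟨.and (.box (.imp (.imp χ .bot) (.box (.imp χ .bot))))
      (.imp (.box (.imp χ .bot)) .bot), .and (.box _) (.imp (.box _) .bot), ?_⟩
    ext x
    simp only [Set.mem_ofPred_eq, MForces, ← hχ]
    constructor
    · rintro ⟨rfl, hP⟩
      exact ⟨hP, fun h => h x (hrefl x) rfl⟩
    · rintro ⟨h1, h2⟩
      have : tp x = t := by
        by_contra hne
        exact h2 (h1 x (hrefl x) hne)
      exact ⟨this, by subst this; exact h1⟩
  have hdia : ∀ t, {x | ∃ y, R x y ∧ tp y = t ∧ P y} ∈ D := by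
    intro t
    obtain ⟨θ, -, hθ⟩ := hPt t
    refine ⟨.imp (.box (.imp θ .bot)) .bot, .imp (.box _) .bot, ?_⟩
    ext x
    have : ∀ y, MForces R V y θ ↔ tp y = t ∧ P y := fun y => (Set.ext_iff.1 hθ y).symm
    simp [MForces, this]
  have hseeP : ∀ x, ∃ y, R x y ∧ tp y = tp x ∧ P y := by
    intro x
    obtain ⟨χ, hχ⟩ := hXt (tp x)
    by_contra! hno
    have := hGrz (fun _ => .imp χ .bot) x
    -- This is **Grz** for `¬χ`: if no point of this type above `x` satisfied `P`, it would give
    -- `¬χ` at `x`.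
    simp only [axGrz, MForm.subst, MForces, ← hχ] at this
    refine this (fun y hxy h hy => hno y hxy hy fun z hyz hne w hzw => ?_) trivial
    rw [hy] at hne ⊢
    exact h z hyz hne w hzw
  let G : W → Set (Set MForm) := fun x => {t | ∃ y, R x y ∧ tp y = t ∧ P y}
  -- The chosen type has the fewest boxed formulas in `G x`, hence those of `x`. It is a function of
  -- `G x` alone, so that the resulting valuation is definable from finitely many sets in `D`.
  let c : Set (Set MForm) → Set MForm := fun G => Classical.epsilon fun t =>
    t ∈ G ∧ ∀ t' ∈ G, ∀ ψ, .box ψ ∈ t → MForm.box ψ ∈ t'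
  have hc : ∀ x, c (G x) ∈ G x ∧ ∀ t' ∈ G x, ∀ ψ, .box ψ ∈ c (G x) → MForm.box ψ ∈ t' := by
    intro x
    refine Classical.epsilon_spec (p := fun t => t ∈ G x ∧ ∀ t' ∈ G x, ∀ ψ, .box ψ ∈ t →
      MForm.box ψ ∈ t') ⟨tp x, hseeP x, ?_⟩
    rintro _ ⟨y, hxy, rfl, -⟩ ψ hψ
    exact ⟨hψ.1, fun z hz => hψ.2 z (hR _ _ _ hxy hz)⟩
  choose u hu1 hu2 hu3 using fun x => (hc x).1
  let e : W → W := fun x => if P x then x else u x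
  let f : W → Set MForm := fun x => if P x then tp x else c (G x)
  have hef : ∀ x, tp (e x) = f x := by
    intro x
    by_cases h : P x
    · simp [e, f, h]
    · simp [e, f, h, hu2]
  have hD : ∀ n, {x | MForm.var n ∈ f x} ∈ D := by
    intro n
    -- For each type, the two Boolean indices record whether `x` is a `P`-point of that type and
    -- whether it sees one; together they determine `f x`.
    refine mem_field_of_saturated (ι := Bool × Set MForm) (I := Set.univ ×ˢ Set.range tp)
      (S := fun i => if i.1 then {x | tp x = i.2 ∧ P x} else {x | i.2 ∈ G x})
      hDuniv hDcompl hDinter (Set.finite_univ.prod htpfin) ?_ ?_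
    · rintro ⟨b, t⟩ -
      cases b
      · exact hdia t
      · exact hPt t
    · intro x y h
      have h1 : ∀ z, (tp x = tp z ∧ P x) ↔ (tp y = tp z ∧ P y) := fun z => by
        simpa using h (true, tp z) ⟨trivial, z, rfl⟩
      have h2 : ∀ z, tp z ∈ G x ↔ tp z ∈ G y := fun z => by
        simpa using h (false, tp z) ⟨trivial, z, rfl⟩
      have hG : G x = G y := by
        ext t
        constructor
        · rintro ⟨z, hz⟩
          rw [← hz.2.1]
          exact (h2 z).1 ⟨z, hz.1, rfl, hz.2.2⟩
        · rintro ⟨z, hz⟩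
          rw [← hz.2.1]
          exact (h2 z).2 ⟨z, hz.1, rfl, hz.2.2⟩
      have hf : f x = f y := by
        by_cases hP : P x
        · obtain ⟨h3, h4⟩ := (h1 x).1 ⟨rfl, hP⟩
          simp [f, hP, h4, h3]
        · have h4 : ¬ P y := fun h4 => hP ((h1 y).2 ⟨rfl, h4⟩).2
          simp [f, hP, h4, hG]
      simp only [Set.mem_ofPred_eq, hf, imp_self]
  choose s hs1 hs2 using hD
  refine ⟨s, hs1, ?_⟩
  have key := mforces_iff_of_type_function (V := V) (V' := fun n => {y | MForces R V y (s n)}) hrefl hR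
    (S := S) (e := e) ?_ ?_ ?_ φ le_rfl
  · obtain ⟨y, -, hy, hPy⟩ := hseeP x
    refine ⟨y, ?_⟩
    rw [mforces_subst, key]
    simpa only [e, hPy, if_true, htp hy φ φ.self_mem_sub] using hx
  · intro x ψ hψ
    by_cases hP : P x
    · simp only [e, hP, if_true]
    · simp only [e, hP, if_false]
      refine ⟨fun h => ?_, fun h z hz => h z (hR _ _ _ (hu1 x) hz)⟩
      have : MForm.box ψ ∈ c (G x) := by
        rw [← hu2]
        exact ⟨hψ, h⟩
      exact ((hc x).2 _ (hseeP x) ψ this).2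
  · intro x
    obtain ⟨y, hxy, hy, hPy⟩ := hseeP x
    refine ⟨y, hxy, fun ψ hψ => ?_⟩
    simpa only [e, hPy, if_true] using htp hy ψ hψ
  · intro n hn x
    rw [← hs2 n, Set.mem_ofPred_eq, ← hef]
    exact ⟨fun h => h.2, fun h => ⟨hn, h⟩⟩

/-! ### Abstraction of boxed formulas by variables -/

namespace MForm

instance : Nonempty MForm := ⟨bot⟩

/-- A numbering of modal formulas. -/
def code : MForm → ℕ
  | var n => Nat.pair 0 n
  | bot => Nat.pair 1 0
  | and φ ψ => Nat.pair 2 (Nat.pair φ.code ψ.code)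
  | or φ ψ => Nat.pair 3 (Nat.pair φ.code ψ.code)
  | imp φ ψ => Nat.pair 4 (Nat.pair φ.code ψ.code)
  | box φ => Nat.pair 5 φ.code

theorem code_injective : Function.Injective code := by
  intro φ
  induction φ with
  | var | bot => intro ψ h; cases ψ <;> simp_all [code, Nat.pair_eq_pair]
  | and a b iha ihb | or a b iha ihb | imp a b iha ihb =>
    intro ψ h
    cases ψ <;> simp only [code, Nat.pair_eq_pair] at h <;> try omega
    rw [iha h.2.1, ihb h.2.2]
  | box a iha =>
    intro ψ h
    cases ψ <;> simp only [code, Nat.pair_eq_pair] at h <;> try omega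
    rw [iha h.2]

/-- Replace the outermost boxed subformulas by variables. -/
def skeleton : MForm → MForm
  | var n => var n
  | bot => bot
  | and φ ψ => and φ.skeleton ψ.skeleton
  | or φ ψ => or φ.skeleton ψ.skeleton
  | imp φ ψ => imp φ.skeleton ψ.skeleton
  | box φ => var φ.code

end MForm

/-- In such a formula every variable lies under a box, so no original variable clashes with a code
in the skeleton. -/
theorem BoxBool.skeleton_subst {φ : MForm} (h : BoxBool φ) :
    φ.skeleton.subst (fun n => .box (Function.invFun MForm.code n)) = φ := by
  induction h with
  | box φ => simp [MForm.skeleton, MForm.subst, Function.leftInverse_invFun MForm.code_injective φ]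
  | bot => rfl
  | and _ _ ih₁ ih₂ | imp _ _ ih₁ ih₂ => simp [MForm.skeleton, MForm.subst, ih₁, ih₂]

/-- A formula outside `τL` has a substitution instance whose necessitation is, over preordered
models with upward closed valuations, the translation of a formula outside `L`. -/
theorem exists_subst_conj_cnf_notMem {L : Set Form} {φ : MForm} (hφ : φ ∉ tau L) :
    ∃ s : ℕ → MForm, Form.conj (φ.subst s).cnf ∉ L := by
  set Γ : Set MForm := {axT, ax4, axGrz} ∪ Form.transl '' L
  let M : Set MForm := {φ | NormalExt Γ φ}
  have hmp : MPClosed .imp M := fun a b => .mp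
  have hax : ∀ {φ}, φ ∈ Γ → ∀ s (x : MaxTheory M), φ.subst s ∈ x.1 :=
    fun h s x => x.2.1 (NormalExt.subst s (.ax h))
  have hrefl : ∀ x : MaxTheory M, x.Rel x := fun x ψ h =>
    x.2.2.1 _ _ (hax (φ := axT) (by simp [Γ]) (fun _ => ψ) x) h
  have hR : ∀ x y z : MaxTheory M, x.Rel y → y.Rel z → x.Rel z := fun x y z hxy hyz ψ h =>
    hyz _ (hxy _ (x.2.2.1 _ _ (hax (φ := ax4) (by simp [Γ]) (fun _ => ψ) x) h))
  obtain ⟨x, -, hx⟩ := exists_maxTheory (T := M) le_rfl hmp hφ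
  rw [← mforces_iff_mem] at hx
  obtain ⟨s, hs, y, hy⟩ := exists_boxBool_subst hrefl hR
    (fun s x => (mforces_iff_mem _ x).2 (hax (φ := axGrz) (by simp [Γ]) s x)) hx
  let d : ℕ → MForm := fun n => .box (Function.invFun MForm.code n)
  refine ⟨fun n => (s n).skeleton, fun hmem => ?_⟩
  have hd : ∀ n (x y : MaxTheory M), x.Rel y →
      x ∈ {z | MForces MaxTheory.Rel (MaxTheory.val M) z (d n)} →
      y ∈ {z | MForces MaxTheory.Rel (MaxTheory.val M) z (d n)} :=
    fun n x y hxy h z hyz => h z (hR _ _ _ hxy hyz)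
  -- Were the formula in `L`, its translation would be an axiom. The instance under `d` restores the
  -- boxed formulas and makes the refuted instance of `φ` true at `y`.
  have h1 := (mforces_iff_mem _ y).2 (hax (Or.inr ⟨_, hmem, rfl⟩) d y)
  rw [mforces_subst, mforces_conj_cnf hrefl
    hd] at h1
  refine hy ?_
  have h2 := h1 y (hrefl y)
  rw [← mforces_subst, MForm.subst_subst] at h2
  simpa only [d, (hs _).skeleton_subst] using h2

/-! ### Frames -/

/-- A partially ordered frame as a modal frame. -/
def Frame.toMFrame (F : Frame.{u}) : MFrame.{u} := ⟨F.World, (· ≤ ·)⟩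

/-- The translation of a formula depends only on the interiors of the values of variables. -/
theorem mforces_transl_congr {V V' : ℕ → Set W}
    (h : ∀ n x, (∀ y, R x y → y ∈ V n) ↔ ∀ y, R x y → y ∈ V' n) (a : Form) (x : W) :
    MForces R V x a.transl ↔ MForces R V' x a.transl := by
  induction a generalizing x with
  | var n => exact h n x
  | bot => rfl
  | and a b iha ihb => exact and_congr (iha x) (ihb x)
  | or a b iha ihb => exact or_congr (iha x) (ihb x)
  | imp a b iha ihb =>
    exact forall_congr' fun y => imp_congr_right fun _ => imp_congr (iha y) (ihb y)

theorem Frame.toMFrame_valid_transl_iff (F : Frame.{u}) (a : Form) :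
    F.toMFrame.Valid a.transl ↔ F.Valid a := by
  refine ⟨fun h V x => (mforces_transl_iff V a x).1 (h _ x), fun h V x => ?_⟩
  let V' : ℕ → UpperSet F.World := fun n =>
    ⟨{x | ∀ y, x ≤ y → y ∈ V n}, fun x y hxy hx z hz => hx z (hxy.trans hz)⟩
  refine (mforces_transl_congr (fun n y => ?_) a x).1 ((mforces_transl_iff V' a x).2 (h V' x))
  exact ⟨fun h z hz => h z hz z (le_refl (α := F.World) z),
    fun h z hz w hw => h w (le_trans (α := F.World) hz hw)⟩

theorem Frame.valid_of_mem_tau {F : Frame.{u}} (hF : F.Noetherian) {L : Set Form}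
    (hL : ∀ a ∈ L, F.Valid a) {φ : MForm} (hφ : φ ∈ tau L) : F.toMFrame.Valid φ := by
  intro V x
  have hwf : WellFounded fun x y : F.World => x > y := by
    rw [RelEmbedding.wellFounded_iff_isEmpty]
    exact ⟨fun f => hF f fun a b h => f.map_rel_iff.2 h⟩
  have h := mforces_of_normalExt (R := F.toMFrame.Rel) (V := V) (fun ψ hψ s y => ?_) hφ .var x
  · rwa [mforces_subst] at h
  · rw [mforces_subst]
    rcases hψ with (rfl | rfl | rfl) | ⟨b, hb, rfl⟩
    · exact fun h => h y (le_refl (α := F.World) y)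
    · exact fun h z hz w hw => h w (le_trans (α := F.World) hz hw)
    · refine mforces_axGrz_of_wellFounded (R := F.toMFrame.Rel) (fun _ _ _ => le_trans (α := F.World))
        (le_refl (α := F.World)) hwf (fun x y z hx hxy hy hyz _ => ?_) y
      exact lt_of_lt_of_le (α := F.World) (lt_of_le_of_ne hxy fun h => hx (h ▸ hy)) hyz
    · exact (F.toMFrame_valid_transl_iff b).2 (hL b hb) _ y

/-- The modal frames of **Grz** are the partial orders without infinite ascending chains. -/
theorem MFrame.exists_frame {F : MFrame.{u}} (hT : F.Valid axT) (h4 : F.Valid ax4)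
    (hGrz : F.Valid axGrz) : ∃ G : Frame.{u}, G.Noetherian ∧ G.toMFrame = F := by
  obtain ⟨W, R⟩ := F
  have hrefl : ∀ x, R x x := fun x => hT (fun _ => {y | R x y}) x fun _ h => h
  have hR : ∀ x y z, R x y → R y z → R x z := fun x y z hxy hyz =>
    h4 (fun _ => {y | R x y}) x (fun _ h => h) y hxy z hyz
  have hanti : ∀ x y, R x y → R y x → x = y := by
    intro x y hxy hyx
    by_contra hne
    -- With `p` false only at `x`, the cycle through `y` falsifies `□(p → □p)` at `x`, so the
    -- premise of **Grz** holds while `p` fails.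
    refine hGrz (fun _ => {x}ᶜ) x (fun z _ h hzx => ?_) rfl
    rw [Set.mem_singleton_iff.1 hzx] at h
    exact h y hxy (fun h => hne h.symm) x hyx rfl
  let o : PartialOrder W :=
    { le := R, le_refl := hrefl, le_trans := hR, le_antisymm := hanti }
  refine ⟨⟨W⟩, fun f hf => ?_, rfl⟩
  -- Let `p` fail exactly at the even members of the chain: from each of them `p` becomes true at
  -- the next member and false again at the one after.
  refine hGrz (fun _ => (Set.range fun n => f (2 * n))ᶜ) (f 0) (fun z _ h hz => ?_) ⟨0, rfl⟩
  obtain ⟨n, rfl⟩ := hz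
  refine h (f (2 * n + 1)) (hf.monotone (Nat.le_succ _)) ?_ (f (2 * (n + 1)))
    (hf.monotone (by omega)) ⟨n + 1, rfl⟩
  rintro ⟨m, hm⟩
  have := hf.injective hm
  omega

theorem acApproximable_of_kripkeComplete {L : Set Form} (hL : IsLogic L)
    (h : KripkeComplete.{u} (tau L)) : ACApproximable.{u} L := by
  obtain ⟨C, hC⟩ := h
  have hval : ∀ F ∈ C, ∀ φ ∈ tau L, F.Valid φ := fun F hF φ hφ => by
    rw [hC] at hφ
    exact hφ F hF
  have hax : ∀ φ ∈ ({axT, ax4, axGrz} : Set MForm), φ ∈ tau L := fun φ h => .ax (.inl h)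
  refine ⟨{G | G.Noetherian ∧ G.toMFrame ∈ C}, fun G hG => hG.1, ?_⟩
  ext a
  refine ⟨fun ha G hG => (G.toMFrame_valid_transl_iff a).1
    (hval _ hG.2 _ (.ax (.inr ⟨a, ha, rfl⟩))), fun ha => mem_of_transl_mem_tau hL ?_⟩
  rw [hC]
  intro F hF
  obtain ⟨G, hG, rfl⟩ := MFrame.exists_frame (hval F hF _ (hax _ (by simp)))
    (hval F hF _ (hax _ (by simp))) (hval F hF _ (hax _ (by simp)))
  exact (G.toMFrame_valid_transl_iff a).2 (ha G ⟨hG, hF⟩)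

theorem kripkeComplete_of_acApproximable {L : Set Form}
    (h : ACApproximable.{u} L) : KripkeComplete.{u} (tau L) := by
  obtain ⟨C, hN, hC⟩ := h
  refine ⟨Frame.toMFrame '' C, ?_⟩
  ext φ
  constructor
  · rintro hφ _ ⟨F, hF, rfl⟩
    refine Frame.valid_of_mem_tau (hN F hF) (fun a ha => ?_) hφ
    rw [hC] at ha
    exact ha F hF
  · intro hφ
    by_contra hn
    obtain ⟨s, hs⟩ := exists_subst_conj_cnf_notMem hn
    refine hs ?_
    rw [hC]
    intro F hF V x
    -- Over an upset valuation the claim becomes the box of a substitution instance of `φ`, which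
    -- holds because `φ` is valid in the frame.
    rw [← mforces_transl_iff, mforces_conj_cnf le_refl (fun n x y hxy h => (V n).upper hxy h)]
    intro y _
    rw [mforces_subst]
    exact hφ _ ⟨F, hF, rfl⟩ _ y

end SILogic

theorem theoremt (L : Set SILogic.Form) (hL : SILogic.IsLogic L) :
    ¬ SILogic.ACApproximable.{u} L ↔ ¬ SILogic.KripkeComplete.{u} (SILogic.tau L) :=
  not_congr ⟨SILogic.kripkeComplete_of_acApproximable,
    SILogic.acApproximable_of_kripkeComplete hL⟩
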